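/- Let $n\ge 1$ and let $G_n$ be the square grid on the $n\times n$ torus, with vertex set $(\mathbb Z/n)^2$, $2n^2$ bonds, and a real number $J_e$ for each bond $e$. Let $G_n^*$ be the dual grid, with vertices $p+(\tfrac12,\tfrac12)$, $p\in(\mathbb Z/n)^2$, and let $e^*$ be the bond of $G_n^*$ that crosses the bond $e$ of $G_n$. The Fisher graph of a square grid on the torus is obtained by replacing each vertex of the grid by two triangles joined by an edge: one triangle carries the right and up bonds of the vertex and one end of the joining edge, the other triangle carries the left and down bonds and the other end (this is the honeycomb lattice with every vertex replaced by a triangle; it has $6n^2$ vertices). Let $F_n$ be the Fisher graph of $G_n^*$ with weight $e^{-2J_e}$ on the edge corresponding to $e^*$ for each bond $e$ of $G_n$, and weight $1$ on all other edges; let its dual $\tilde F_n$ be the Fisher graph of $G_n$ with weight $\tanh J_e$ on the edge corresponding to $e$, and weight $1$ on all other edges. Both have the same underlying graph on the torus (translate by $(\tfrac12,\tfrac12)$). Give both the same orientation, which may be any clockwise odd one: every face (triangle or dodecagon) on the torus has an odd number of edges pointing along it when its boundary is traversed clockwise. Let $K$ be the Kasteleyn matrix: $K_{uv}=W(uv)$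 if the edge $uv$ is oriented from $u$ to $v$, $K_{uv}=-W(uv)$ if it is oriented from $v$ to $u$, and $K_{uv}=0$ if $uv$ is not an edge, where $W$ is the weight. Let $\gamma_x$ (respectively $\gamma_y$) be a straight path in the dual of the Fisher graph that winds once horizontally (respectively vertically) around the torus and crosses exactly $n$ edges, those corresponding to the vertical (respectively horizontal) bonds between two consecutive rows (respectively columns). For $z,w\in\mathbb C^*$ let $K(z,w)$ be $K$ with the entry $K_{uv}$ of each edge crossed by $\gamma_x$ multiplied by $z$ if the edge is oriented from $u$ to $v$ and by $1/z$ otherwise, and similarly with $w$ for $\gamma_y$. Put $P(z,w)=\det K(z,w)$. Then for all $\theta,\tau\in\{0,1\}$, $$P_{F_n}\big((-1)^\theta,(-1)^\tau\big)=0\iff P_{\tilde F_n}\big((-1)^\theta,(-1)^\tau\big)=0 .$$ -/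

import Mathlib

namespace FisherTorus

/-- Cells of the `n × n` torus, with coordinates in `ℤ/n`. -/
abbrev Cell (n : ℕ) := ZMod n × ZMod n

/-- The cell to the right. -/
def east {n : ℕ} (p : Cell n) : Cell n := (p.1 + 1, p.2)

/-- The cell above. -/
def north {n : ℕ} (p : Cell n) : Cell n := (p.1, p.2 + 1)

/-- The `2 n²` bonds of the square grid on the torus: `hor p` joins `p` to `east p`, and
`ver p` joins `p` to `north p`. -/
inductive Bond (n : ℕ)
  | hor (p : Cell n)
  | ver (p : Cell n)

/-- The dual bond. The vertex of the dual grid named `p` is the centre `p + (1/2, 1/2)` of the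
face whose lower left corner is `p`. The bond from `p` to `p + (1, 0)` is crossed by the vertical
dual bond from `p - (0, 1)` to `p`; the bond from `p` to `p + (0, 1)` is crossed by the horizontal
dual bond from `p - (1, 0)` to `p`. -/
def dualBond {n : ℕ} : Bond n ≃ Bond n where
  toFun
    | .hor p => .ver (p.1, p.2 - 1)
    | .ver p => .hor (p.1 - 1, p.2)
  invFun
    | .hor p => .ver (east p)
    | .ver p => .hor (north p)
  left_inv b := by cases b <;> simp [east, north]
  right_inv b := by cases b <;> simp [east, north]

/-- The six vertices of the gadget replacing a vertex of the square grid: the triangle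
`hubNE, right, up`, the triangle `hubSW, left, down`, and an edge joining the two hubs.
The vertices `right, up, left, down` carry the bonds leaving in these directions. -/
inductive Site
  | hubNE
  | right
  | up
  | hubSW
  | left
  | down
  deriving DecidableEq

instance : Fintype Site where
  elems := {.hubNE, .right, .up, .hubSW, .left, .down}
  complete s := by cases s <;> decide

/-- Vertices of the Fisher graph on the `n × n` torus. -/
abbrev Vertex (n : ℕ) := Cell n × Site

/-- The edges of the Fisher graph, each listed in one direction. -/
inductive Link {n : ℕ} : Vertex n → Vertex n → Prop
  | hubNE_right (p : Cell n) : Link (p, .hubNE) (p, .right)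
  | right_up (p : Cell n) : Link (p, .right) (p, .up)
  | up_hubNE (p : Cell n) : Link (p, .up) (p, .hubNE)
  | hubSW_left (p : Cell n) : Link (p, .hubSW) (p, .left)
  | left_down (p : Cell n) : Link (p, .left) (p, .down)
  | down_hubSW (p : Cell n) : Link (p, .down) (p, .hubSW)
  | hub (p : Cell n) : Link (p, .hubSW) (p, .hubNE)
  | hor (p : Cell n) : Link (p, .right) (east p, .left)
  | ver (p : Cell n) : Link (p, .up) (north p, .down)

/-- The Fisher graph on the `n × n` torus: the honeycomb lattice with each vertex replaced by a
triangle. -/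
def fisherGraph (n : ℕ) : SimpleGraph (Vertex n) := SimpleGraph.fromRel Link

/-- The weight of the edge `uv` of the Fisher graph, when the bonds of the square grid
have weights `x`: the edges corresponding to bonds have the weight of the bond, all other
edges have weight `1`. (Used only for adjacent `u` and `v`.) -/
def edgeWeight {n : ℕ} (x : Bond n → ℝ) : Vertex n → Vertex n → ℝ
  | (p, .right), (_, .left) => x (.hor p)
  | (_, .left), (p, .right) => x (.hor p)
  | (p, .up), (_, .down) => x (.ver p)
  | (_, .down), (p, .up) => x (.ver p)
  | _, _ => 1

/-- An orientation of the edges of the Fisher graph; `arrow u v` means that `uv` is an edge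
oriented from `u` to `v`. -/
structure Orientation (n : ℕ) where
  arrow : Vertex n → Vertex n → Prop
  adj_iff : ∀ u v, (fisherGraph n).Adj u v ↔ (arrow u v ∨ arrow v u)
  asymm : ∀ u v, arrow u v → ¬ arrow v u

/-- The clockwise boundary of the triangular face `hubNE, up, right` of the cell `p`. -/
def faceNE {n : ℕ} (p : Cell n) : Fin 3 → Vertex n :=
  ![(p, .hubNE), (p, .up), (p, .right)]

/-- The clockwise boundary of the triangular face `hubSW, down, left` of the cell `p`. -/
def faceSW {n : ℕ} (p : Cell n) : Fin 3 → Vertex n :=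
  ![(p, .hubSW), (p, .down), (p, .left)]

/-- The clockwise boundary of the dodecagonal face between the cells
`p`, `north p`, `north (east p)`, `east p`. -/
def faceBig {n : ℕ} (p : Cell n) : Fin 12 → Vertex n :=
  ![(p, .right), (p, .up),
    (north p, .down), (north p, .hubSW), (north p, .hubNE), (north p, .right),
    (north (east p), .left), (north (east p), .down),
    (east p, .up), (east p, .hubNE), (east p, .hubSW), (east p, .left)]

open Classical in
/-- The number of steps of the closed walk `f 0, f 1, …, f (k - 1), f 0` that follow the
orientation. -/
noncomputable def Orientation.forward {n k : ℕ} [NeZero k] (o : Orientation n)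
    (f : Fin k → Vertex n) : ℕ :=
  ∑ i : Fin k, if o.arrow (f i) (f (i + 1)) then 1 else 0

/-- Every face of the Fisher graph on the torus has an odd number of edges pointing along it
when it is traversed clockwise. -/
def Orientation.ClockwiseOdd {n : ℕ} (o : Orientation n) : Prop :=
  ∀ p : Cell n, Odd (o.forward (faceNE p)) ∧ Odd (o.forward (faceSW p)) ∧
    Odd (o.forward (faceBig p))

/-- The edge `uv` is crossed by the horizontal dual path `γ_x`, which runs between the
rows `-1` and `0`. -/
def CrossesX {n : ℕ} (u v : Vertex n) : Prop :=
  ∃ a : ZMod n, s(u, v) = s(((a, -1), Site.up), ((a, 0), Site.down))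

/-- The edge `uv` is crossed by the vertical dual path `γ_y`, which runs between the
columns `-1` and `0`. -/
def CrossesY {n : ℕ} (u v : Vertex n) : Prop :=
  ∃ b : ZMod n, s(u, v) = s(((-1, b), Site.right), ((0, b), Site.left))

open Classical in
/-- The Kasteleyn matrix: the weighted skew-symmetric adjacency matrix of the oriented
Fisher graph. -/
noncomputable def kasteleyn {n : ℕ} (o : Orientation n) (x : Bond n → ℝ) :
    Matrix (Vertex n) (Vertex n) ℂ :=
  Matrix.of fun u v =>
    if o.arrow u v then (edgeWeight x u v : ℂ)
    else if o.arrow v u then -(edgeWeight x u v : ℂ)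
    else 0

open Classical in
/-- The matrix `K(z, w)`: the `(u, v)` entry of the Kasteleyn matrix, for an edge `uv` crossed by
`γ_x`, is multiplied by `z` if the edge is oriented from `u` to `v` and by `1/z` otherwise;
similarly with `w` for `γ_y`. -/
noncomputable def kasteleynZW {n : ℕ} (o : Orientation n) (x : Bond n → ℝ) (z w : ℂ) :
    Matrix (Vertex n) (Vertex n) ℂ :=
  Matrix.of fun u v =>
    kasteleyn o x u v
      * (if CrossesX u v then (if o.arrow u v then z else z⁻¹) else 1)
      * (if CrossesY u v then (if o.arrow u v then w else w⁻¹) else 1)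

/-- The characteristic polynomial `P(z, w) = det K(z, w)`, for nonzero complex `z` and `w`. -/
noncomputable def charPoly {n : ℕ} [NeZero n] (o : Orientation n) (x : Bond n → ℝ) (z w : ℂ) : ℂ :=
  (kasteleynZW o x z w).det

/-- The weights `e^{-2 J_e}` on the bonds dual to the bonds `e`. -/
noncomputable def lowTempWeight {n : ℕ} (J : Bond n → ℝ) : Bond n → ℝ :=
  fun b => Real.exp (-2 * J (dualBond.symm b))

/-- The weights `tanh J_e` on the bonds `e`. -/
noncomputable def highTempWeight {n : ℕ} (J : Bond n → ℝ) : Bond n → ℝ :=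
  fun b => Real.tanh (J b)

end FisherTorus

namespace FisherTorus

/-! ### The corner system and its duality -/

/-! The determinants are compared through their kernels. Since `z` and `w` are `±1`, `K(z, w)` is
again a signed adjacency matrix, and it still satisfies the clockwise odd condition on every face
(`Orientation.ClockwiseOdd.isKasteleynSign`). A change of vertex signs standardises all edges inside
the cells. What is left is a sign `h` or `v` on each bond, with product `1` around every face of the
square grid (`IsKasteleynSign.horSign_mul_verSign`). These signs do not depend on the weights.

The two hub equations of a cell leave four free variables out of six. Written in terms of one
variable per corner of the cell, the other four equations become two relations at each bond, so the
determinant vanishes iff `IsCornerSolution` has a nonzero solution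
(`IsKasteleynSign.det_signedMatrix_eq_zero_iff`).

A corner of a cell is also a corner of a vertex of the dual grid: the north-east corner of `p` is
the south-west corner of the dual vertex `p`, and so on. Under this relabelling, with signs
transported along bonds, the relations at a bond of weight `x` turn into those at its dual bond of
weight `y = (1 - x) / (1 + x)` (`isCornerSolution_dualCorner`). For `x = tanh J` this is `y =
e^{-2J}`. -/

/-- The linear relations of corner variables: `φ 0`, `φ 1`, `φ 2`, `φ 3` are the variables at the
north-east, north-west, south-west and south-east corners of each cell, `h` and `v` are the signs
of the horizontal and vertical bonds, and `x` gives the bond weights. -/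
def IsCornerSolution {n : ℕ} (h v : Cell n → ℂ) (x : Bond n → ℂ) (φ : Fin 4 → Cell n → ℂ) : Prop :=
  ∀ p : Cell n,
    (φ 3 p - φ 0 p + h p * x (.hor p) * (φ 2 (east p) - φ 1 (east p)) = 0 ∧
      φ 1 (east p) + φ 2 (east p) + h p * x (.hor p) * (φ 0 p + φ 3 p) = 0) ∧
    (-(φ 0 p + φ 1 p) + v p * x (.ver p) * (φ 3 (north p) - φ 2 (north p)) = 0 ∧
      φ 2 (north p) + φ 3 (north p) + v p * x (.ver p) * (φ 1 p - φ 0 p) = 0)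

/-- The same corner variables, seen from the vertices of the dual grid. -/
def dualCorner {n : ℕ} (h v : Cell n → ℂ) (φ : Fin 4 → Cell n → ℂ) : Fin 4 → Cell n → ℂ :=
  ![fun p => -(v p * h (north p) * φ 2 (north (east p))),
    fun p => -(v p * φ 3 (north p)),
    fun p => φ 0 p,
    fun p => h p * φ 1 (east p)]

/-- The cell to the left. -/
def west {n : ℕ} (p : Cell n) : Cell n := (p.1 - 1, p.2)

/-- The cell below. -/
def south {n : ℕ} (p : Cell n) : Cell n := (p.1, p.2 - 1)

@[simp] theorem east_west {n : ℕ} (p : Cell n) : east (west p) = p := by simp [east, west]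
@[simp] theorem west_east {n : ℕ} (p : Cell n) : west (east p) = p := by simp [east, west]
@[simp] theorem north_south {n : ℕ} (p : Cell n) : north (south p) = p := by simp [north, south]
@[simp] theorem south_north {n : ℕ} (p : Cell n) : south (north p) = p := by simp [north, south]

theorem dualCorner_surjective {n : ℕ} {h v : Cell n → ℂ} (hh : ∀ p, h p * h p = 1)
    (hv : ∀ p, v p * v p = 1) : Function.Surjective (dualCorner h v) := by
  intro φ
  refine ⟨![fun p => φ 2 p, fun p => h (west p) * φ 3 (west p),
    fun p => -(v (west (south p)) * h (north (west (south p))) * φ 0 (west (south p))),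
    fun p => -(v (south p) * φ 1 (south p))], ?_⟩
  funext i p
  fin_cases i
  · simp [dualCorner]
    linear_combination (v p * v p * φ 0 p) * hh (north p) + φ 0 p * hv p
  · simp [dualCorner]
    linear_combination φ 1 p * hv p
  · simp [dualCorner]
  · simp [dualCorner]
    linear_combination φ 3 p * hh p

theorem dualCorner_ne_zero {n : ℕ} {h v : Cell n → ℂ} (hh : ∀ p, h p * h p = 1)
    (hv : ∀ p, v p * v p = 1) {φ : Fin 4 → Cell n → ℂ} : dualCorner h v φ ≠ 0 ↔ φ ≠ 0 := by
  have hh' : ∀ p, h p ≠ 0 := fun p e => by simpa [e] using hh p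
  have hv' : ∀ p, v p ≠ 0 := fun p e => by simpa [e] using hv p
  refine not_congr ⟨fun e => ?_, fun e => ?_⟩
  · funext i p
    fin_cases i
    · simpa [dualCorner] using congrFun (congrFun e 2) p
    · simpa [dualCorner, hh'] using congrFun (congrFun e 3) (west p)
    · have := congrFun (congrFun e 0) (west (south p))
      simpa [dualCorner, hh', hv'] using this
    · simpa [dualCorner, hv'] using congrFun (congrFun e 1) (south p)
  · subst e
    funext i p
    fin_cases i <;> simp [dualCorner]

theorem isCornerSolution_iff_hor_ver {n : ℕ} {h v : Cell n → ℂ} {x : Bond n → ℂ}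
    {φ : Fin 4 → Cell n → ℂ} : IsCornerSolution h v x φ ↔
    (∀ p, φ 3 p - φ 0 p + h p * x (.hor p) * (φ 2 (east p) - φ 1 (east p)) = 0 ∧
      φ 1 (east p) + φ 2 (east p) + h p * x (.hor p) * (φ 0 p + φ 3 p) = 0) ∧
    (∀ p, -(φ 0 p + φ 1 p) + v p * x (.ver p) * (φ 3 (north p) - φ 2 (north p)) = 0 ∧
      φ 2 (north p) + φ 3 (north p) + v p * x (.ver p) * (φ 1 p - φ 0 p) = 0) :=
  forall_and

/-- Kramers–Wannier duality of the relations at a horizontal bond. -/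
theorem hor_relations_dual {h v x y a b c d : ℂ} (hh : h * h = 1) (hv : v * v = 1)
    (hx : 1 + x ≠ 0) (hxy : y * (1 + x) = 1 - x) :
    (-(-(v * h * c) + -(v * d)) + v * y * (h * b - a) = 0 ∧
      a + h * b + v * y * (-(v * d) - -(v * h * c)) = 0) ↔
    (d - a + h * x * (c - b) = 0 ∧ b + c + h * x * (a + d) = 0) := by
  constructor
  · rintro ⟨e1, e2⟩
    have e1' : h * c + d + y * (h * b - a) = 0 := by
      linear_combination v * e1 - (h * c + d + y * (h * b - a)) * hv
    have e2' : a + h * b - y * (d - h * c) = 0 := by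
      linear_combination e2 + (y * (d - h * c)) * hv
    constructor
    -- After multiplication by `1 + x`, the factor `y * (1 + x)` becomes `1 - x`. Adding or
    -- subtracting the relations then leaves coefficients `2` and `2 * x`, hence the `1/2`.
    · linear_combination (1/2 : ℂ) * ((1 + x) * e1' - (1 + x) * e2') +
        (-(1/2 : ℂ) * (h * b - a + d - h * c)) * hxy
    · linear_combination (1/2 : ℂ) * h * ((1 + x) * e1' + (1 + x) * e2') +
        (-(1/2 : ℂ) * h * (h * b - a - d + h * c)) * hxy - (b + c) * hh
  · rintro ⟨e1, e2⟩
    have e1' : h * c + d + y * (h * b - a) = 0 := by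
      refine (mul_eq_zero.1 ?_).resolve_left hx
      linear_combination e1 + h * e2 + (h * b - a) * hxy - (x * (a + d)) * hh
    have e2' : a + h * b - y * (d - h * c) = 0 := by
      refine (mul_eq_zero.1 ?_).resolve_left hx
      linear_combination h * e2 - e1 - (d - h * c) * hxy - (x * (a + d)) * hh
    constructor
    · linear_combination v * e1'
    · linear_combination e2' - (y * (d - h * c)) * hv

/-- Kramers–Wannier duality of the relations at a vertical bond. -/
theorem ver_relations_dual {h v x y a b c d : ℂ} (hh : h * h = 1) (hv : v * v = 1)
    (hx : 1 + x ≠ 0) (hxy : y * (1 + x) = 1 - x) :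
    (h * b - -(h * v * c) + h * y * (a - -(v * d)) = 0 ∧
      -(v * d) + a + h * y * (-(h * v * c) + h * b) = 0) ↔
    (-(a + b) + v * x * (d - c) = 0 ∧ c + d + v * x * (b - a) = 0) := by
  constructor
  · rintro ⟨e1, e2⟩
    have e1' : b + v * c + y * (a + v * d) = 0 := by
      linear_combination h * e1 - (b + v * c + y * (a + v * d)) * hh
    have e2' : a - v * d + y * (b - v * c) = 0 := by
      linear_combination e2 - (y * (b - v * c)) * hh
    constructor
    · linear_combination (-1/2 : ℂ) * ((1 + x) * e1' + (1 + x) * e2') +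
        ((1/2 : ℂ) * (a + v * d + b - v * c)) * hxy
    · linear_combination (1/2 : ℂ) * v * ((1 + x) * e1' - (1 + x) * e2') -
        ((1/2 : ℂ) * v * (a + v * d - b + v * c)) * hxy - (c + d) * hv
  · rintro ⟨e1, e2⟩
    have e1' : b + v * c + y * (a + v * d) = 0 := by
      refine (mul_eq_zero.1 ?_).resolve_left hx
      linear_combination v * e2 - e1 + (a + v * d) * hxy - (x * (b - a)) * hv
    have e2' : a - v * d + y * (b - v * c) = 0 := by
      refine (mul_eq_zero.1 ?_).resolve_left hx
      linear_combination -v * e2 - e1 + (b - v * c) * hxy + (x * (b - a)) * hv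
    constructor
    · linear_combination h * e1'
    · linear_combination e2' + (y * (b - v * c)) * hh

/-- Duality holds bond by bond. Horizontal bonds are crossed by vertical dual bonds and conversely,
so the two families of relations are exchanged. The face condition `hf` makes the sign carried from
`p` to `north (east p)` independent of the route around the face. -/
theorem isCornerSolution_dualCorner {n : ℕ} {h v : Cell n → ℂ} (hh : ∀ p, h p * h p = 1)
    (hv : ∀ p, v p * v p = 1) (hf : ∀ p, h p * v (east p) * h (north p) * v p = 1)
    {x y : Bond n → ℂ} (hx : ∀ b, 1 + x b ≠ 0)
    (hxy : ∀ b, y (dualBond b) * (1 + x b) = 1 - x b) {φ : Fin 4 → Cell n → ℂ} :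
    IsCornerSolution h v y (dualCorner h v φ) ↔ IsCornerSolution h v x φ := by
  rw [isCornerSolution_iff_hor_ver, isCornerSolution_iff_hor_ver, and_comm]
  have surjN : Function.Surjective (north (n := n)) := fun p => ⟨south p, by simp⟩
  have surjE : Function.Surjective (east (n := n)) := fun p => ⟨west p, by simp⟩
  refine and_congr ?_ ?_
  · rw [surjN.forall (p := fun p => φ 3 p - φ 0 p + _ = 0 ∧ _)]
    refine forall_congr' fun p => ?_
    have key := hxy (.hor (north p))
    have hd : dualBond (.hor (north p)) = .ver p := by simp [dualBond, north]
    rw [hd] at key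
    have hen : north (east p) = east (north p) := rfl
    rw [← hor_relations_dual (v := v p) (hh (north p)) (hv p) (hx _) key]
    simp [dualCorner, hen]
  · rw [surjE.forall (p := fun p => -(φ 0 p + φ 1 p) + _ = 0 ∧ _)]
    refine forall_congr' fun p => ?_
    have key := hxy (.ver (east p))
    have hd : dualBond (.ver (east p)) = .hor p := by simp [dualBond, east]
    rw [hd] at key
    -- `dualCorner` transports the sign by going up and then right, while the relation at `ver (east
    -- p)` needs right and then up.
    have hs : v p * h (north p) = h p * v (east p) := by
      linear_combination (h p * v (east p)) * hf p - (v p * h (north p)) * hh p -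
        (h p * h p * v p * h (north p)) * hv (east p)
    rw [← ver_relations_dual (h := h p) (hh p) (hv (east p)) (hx _) key]
    simp [dualCorner, hs]

theorem exists_isCornerSolution_dual {n : ℕ} {h v : Cell n → ℂ} (hh : ∀ p, h p * h p = 1)
    (hv : ∀ p, v p * v p = 1) (hf : ∀ p, h p * v (east p) * h (north p) * v p = 1)
    {x y : Bond n → ℂ} (hx : ∀ b, 1 + x b ≠ 0)
    (hxy : ∀ b, y (dualBond b) * (1 + x b) = 1 - x b) :
    (∃ φ, φ ≠ 0 ∧ IsCornerSolution h v y φ) ↔ ∃ φ, φ ≠ 0 ∧ IsCornerSolution h v x φ := by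
  rw [(dualCorner_surjective hh hv).exists]
  simp only [dualCorner_ne_zero hh hv, isCornerSolution_dualCorner hh hv hf hx hxy]

end FisherTorus

namespace FisherTorus

/-! ### Signs of an orientation -/

theorem Link.adj {n : ℕ} {u v : Vertex n} (l : Link u v) : (fisherGraph n).Adj u v := by
  refine (SimpleGraph.fromRel_adj _ _ _).2 ⟨?_, Or.inl l⟩
  cases l <;> simp

open Classical in
/-- The sign `±1` of an edge in the given orientation, and `0` if there is no edge. -/
noncomputable def Orientation.sign {n : ℕ} (o : Orientation n) (u v : Vertex n) : ℂ :=
  if o.arrow u v then 1 else if o.arrow v u then -1 else 0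

theorem Orientation.sign_swap {n : ℕ} (o : Orientation n) (u v : Vertex n) :
    o.sign v u = -o.sign u v := by
  have h₁ := o.asymm u v
  by_cases h : o.arrow u v <;> by_cases h' : o.arrow v u <;> simp_all [sign]

theorem Orientation.sign_mul_self {n : ℕ} (o : Orientation n) {u v : Vertex n}
    (l : Link u v) : o.sign u v * o.sign u v = 1 := by
  rcases (o.adj_iff u v).1 l.adj with h | h
  · simp [sign, h]
  · simp [sign, h, o.asymm _ _ h]

theorem Orientation.sign_eq_zero {n : ℕ} (o : Orientation n) {u v : Vertex n}
    (huv : ¬ Link u v) (hvu : ¬ Link v u) : o.sign u v = 0 := by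
  have h : ¬ (fisherGraph n).Adj u v := by
    simp [fisherGraph, SimpleGraph.fromRel_adj, huv, hvu]
  rw [o.adj_iff, not_or] at h
  simp [sign, h.1, h.2]

/-- A step along the orientation contributes `-1` and a step against it `1`. Removing the `k` minus
signs gives sign product `1` around a triangle and `-1` around a dodecagon. -/
theorem Orientation.prod_neg_sign {n k : ℕ} [NeZero k] (o : Orientation n) {f : Fin k → Vertex n}
    (hf : ∀ i, Link (f i) (f (i + 1)) ∨ Link (f (i + 1)) (f i)) (ho : Odd (o.forward f)) :
    ∏ i, -o.sign (f i) (f (i + 1)) = -1 := by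
  classical
  rw [← ho.neg_one_pow, forward, ← Finset.prod_pow_eq_pow_sum]
  refine Finset.prod_congr rfl fun i _ => ?_
  have h := (o.adj_iff (f i) (f (i + 1))).1 ((hf i).elim Link.adj fun l => l.adj.symm)
  by_cases h' : o.arrow (f i) (f (i + 1)) <;> simp_all [sign]

theorem Orientation.ClockwiseOdd.sign_faceNE {n : ℕ} {o : Orientation n} (ho : o.ClockwiseOdd)
    (p : Cell n) : o.sign (p, .hubNE) (p, .up) * o.sign (p, .up) (p, .right) *
      o.sign (p, .right) (p, .hubNE) = 1 := by
  have h := o.prod_neg_sign (f := faceNE p) (fun i => by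
    fin_cases i
    · exact Or.inr (.up_hubNE p)
    · exact Or.inr (.right_up p)
    · exact Or.inr (.hubNE_right p)) (ho p).1
  simp [Fin.prod_univ_succ, faceNE] at h
  linear_combination h

theorem Orientation.ClockwiseOdd.sign_faceSW {n : ℕ} {o : Orientation n} (ho : o.ClockwiseOdd)
    (p : Cell n) : o.sign (p, .hubSW) (p, .down) * o.sign (p, .down) (p, .left) *
      o.sign (p, .left) (p, .hubSW) = 1 := by
  have h := o.prod_neg_sign (f := faceSW p) (fun i => by
    fin_cases i
    · exact Or.inr (.down_hubSW p)
    · exact Or.inr (.left_down p)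
    · exact Or.inr (.hubSW_left p)) (ho p).2.1
  simp [Fin.prod_univ_succ, faceSW] at h
  linear_combination h

theorem Orientation.ClockwiseOdd.sign_faceBig {n : ℕ} {o : Orientation n} (ho : o.ClockwiseOdd)
    (p : Cell n) :
    o.sign (p, .right) (p, .up) * o.sign (p, .up) (north p, .down) *
      o.sign (north p, .down) (north p, .hubSW) * o.sign (north p, .hubSW) (north p, .hubNE) *
      o.sign (north p, .hubNE) (north p, .right) *
      o.sign (north p, .right) (north (east p), .left) *
      o.sign (north (east p), .left) (north (east p), .down) *
      o.sign (north (east p), .down) (east p, .up) *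
      o.sign (east p, .up) (east p, .hubNE) * o.sign (east p, .hubNE) (east p, .hubSW) *
      o.sign (east p, .hubSW) (east p, .left) * o.sign (east p, .left) (p, .right) = -1 := by
  have h := o.prod_neg_sign (f := faceBig p) (fun i => by
    fin_cases i
    · exact Or.inl (.right_up p)
    · exact Or.inl (.ver p)
    · exact Or.inl (.down_hubSW _)
    · exact Or.inl (.hub _)
    · exact Or.inl (.hubNE_right _)
    · exact Or.inl (.hor (north p))
    · exact Or.inl (.left_down _)
    · exact Or.inr (.ver (east p))
    · exact Or.inl (.up_hubNE _)
    · exact Or.inr (.hub _)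
    · exact Or.inl (.hubSW_left _)
    · exact Or.inr (.hor p)) (ho p).2.2
  simp [Fin.prod_univ_succ, faceBig] at h
  linear_combination h

/-! ### The matrix `K(z, w)` at signs `z` and `w` -/

theorem CrossesX.symm {n : ℕ} {u v : Vertex n} : CrossesX u v ↔ CrossesX v u := by
  simp only [CrossesX, Sym2.eq_swap (a := u)]

theorem CrossesY.symm {n : ℕ} {u v : Vertex n} : CrossesY u v ↔ CrossesY v u := by
  simp only [CrossesY, Sym2.eq_swap (a := u)]

theorem crossesX_ver {n : ℕ} (p : Cell n) :
    CrossesX (p, .up) (north p, .down) ↔ p.2 = -1 := by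
  obtain ⟨a, b⟩ := p
  simp only [CrossesX, north, Sym2.eq_iff, Prod.mk.injEq, reduceCtorEq, and_false, and_true,
    or_false]
  constructor
  · rintro ⟨_, ⟨_, h⟩, _⟩
    exact h
  · rintro rfl
    exact ⟨a, by simp⟩

theorem crossesY_hor {n : ℕ} (p : Cell n) :
    CrossesY (p, .right) (east p, .left) ↔ p.1 = -1 := by
  obtain ⟨a, b⟩ := p
  simp only [CrossesY, east, Sym2.eq_iff, Prod.mk.injEq, reduceCtorEq, and_false, and_true,
    or_false]
  constructor
  · rintro ⟨_, ⟨h, _⟩, _⟩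
    exact h
  · rintro rfl
    exact ⟨b, by simp⟩

open Classical in
/-- The sign of an edge, with the signs `z` and `w` for the edges crossed by `γ_x` and `γ_y`. -/
noncomputable def Orientation.twistedSign {n : ℕ} (o : Orientation n) (z w : ℂ)
    (u v : Vertex n) : ℂ :=
  o.sign u v * (if CrossesX u v then z else 1) * (if CrossesY u v then w else 1)

/-- Because `z` and `w` equal their inverses, the multiplier no longer depends on the orientation of
the crossed edge. -/
theorem kasteleynZW_apply {n : ℕ} (o : Orientation n) (x : Bond n → ℝ) {z w : ℂ}
    (hz : z * z = 1) (hw : w * w = 1) (u v : Vertex n) :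
    kasteleynZW o x z w u v = o.twistedSign z w u v * edgeWeight x u v := by
  have hz' : z⁻¹ = z := inv_eq_of_mul_eq_one_left hz
  have hw' : w⁻¹ = w := inv_eq_of_mul_eq_one_left hw
  simp only [kasteleynZW, kasteleyn, Matrix.of_apply, hz', hw', ite_self,
    Orientation.twistedSign, Orientation.sign]
  by_cases h : o.arrow u v
  · simp only [h, if_true]; ring
  · by_cases h' : o.arrow v u
    · simp only [h, h', if_true, if_false]; ring
    · simp [h, h']

/-- Signs on the edges of the Fisher graph that are those of a clockwise odd orientation. -/
structure IsKasteleynSign {n : ℕ} (σ : Vertex n → Vertex n → ℂ) : Prop where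
  swap : ∀ u v, σ v u = -σ u v
  mul_self : ∀ u v, Link u v → σ u v * σ u v = 1
  eq_zero : ∀ u v, ¬ Link u v → ¬ Link v u → σ u v = 0
  faceNE : ∀ p, σ (p, .hubNE) (p, .up) * σ (p, .up) (p, .right) * σ (p, .right) (p, .hubNE) = 1
  faceSW : ∀ p, σ (p, .hubSW) (p, .down) * σ (p, .down) (p, .left) * σ (p, .left) (p, .hubSW) = 1
  faceBig : ∀ p, σ (p, .right) (p, .up) * σ (p, .up) (north p, .down) *
      σ (north p, .down) (north p, .hubSW) * σ (north p, .hubSW) (north p, .hubNE) *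
      σ (north p, .hubNE) (north p, .right) * σ (north p, .right) (north (east p), .left) *
      σ (north (east p), .left) (north (east p), .down) *
      σ (north (east p), .down) (east p, .up) *
      σ (east p, .up) (east p, .hubNE) * σ (east p, .hubNE) (east p, .hubSW) *
      σ (east p, .hubSW) (east p, .left) * σ (east p, .left) (p, .right) = -1

/-- The paths `γ_x` and `γ_y` miss the triangles and cross the boundary of each dodecagon zero or
two times, so the twist multiplies face products by powers of `z * z` and `w * w`. -/
theorem Orientation.ClockwiseOdd.isKasteleynSign {n : ℕ} {o : Orientation n}
    (ho : o.ClockwiseOdd) {z w : ℂ} (hz : z * z = 1) (hw : w * w = 1) :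
    IsKasteleynSign (o.twistedSign z w) where
  swap u v := by
    rw [twistedSign, twistedSign, o.sign_swap, CrossesX.symm, CrossesY.symm]
    ring
  mul_self u v l := by
    have h := o.sign_mul_self l
    rw [twistedSign]
    split_ifs
    · linear_combination z * z * w * w * h + w * w * hz + hw
    · linear_combination z * z * h + hz
    · linear_combination w * w * h + hw
    · linear_combination h
  eq_zero u v h h' := by simp [twistedSign, o.sign_eq_zero h h']
  faceNE p := by
    simpa [twistedSign, CrossesX, CrossesY] using ho.sign_faceNE p
  faceSW p := by
    simpa [twistedSign, CrossesX, CrossesY] using ho.sign_faceSW p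
  faceBig p := by
    have hX : ∀ a b : Site, (a, b) ≠ (.up, .down) → (a, b) ≠ (.down, .up) →
        ∀ p q : Cell n, ¬ CrossesX (p, a) (q, b) := by
      rintro a b h h' p q ⟨c, hc⟩
      simp only [Sym2.eq_iff, Prod.mk.injEq] at hc
      aesop
    have hY : ∀ a b : Site, (a, b) ≠ (.right, .left) → (a, b) ≠ (.left, .right) →
        ∀ p q : Cell n, ¬ CrossesY (p, a) (q, b) := by
      rintro a b h h' p q ⟨c, hc⟩
      simp only [Sym2.eq_iff, Prod.mk.injEq] at hc
      aesop
    have h := ho.sign_faceBig p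
    have h1 := crossesX_ver p
    have h2 := crossesX_ver (east p)
    rw [CrossesX.symm] at h2
    have h3 := crossesY_hor p
    rw [CrossesY.symm] at h3
    have h4 := crossesY_hor (north p)
    have hen : east (north p) = north (east p) := rfl
    have e1 : (north p).1 = p.1 := rfl
    have e2 : (east p).2 = p.2 := rfl
    rw [e2] at h2
    rw [hen, e1] at h4
    simp only [twistedSign, h1, h2, h3, h4]
    simp (disch := decide) only [hX, hY, if_false, mul_one]
    by_cases c1 : p.1 = -1 <;> by_cases c2 : p.2 = -1 <;> simp only [c1, c2, if_true, if_false]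
    · linear_combination z * z * w * w * h - w * w * hz - hw
    · linear_combination w * w * h - hw
    · linear_combination z * z * h - hz
    · linear_combination h

end FisherTorus

open Matrix
namespace FisherTorus

/-! ### Kernel vectors and corner solutions -/

/-- The matrix with the given signs and bond weights. -/
noncomputable def signedMatrix {n : ℕ} (σ : Vertex n → Vertex n → ℂ) (x : Bond n → ℝ) :
    Matrix (Vertex n) (Vertex n) ℂ :=
  Matrix.of fun u v => σ u v * edgeWeight x u v

/-! ### The rows of the signed matrix, each with three neighbours. -/

theorem mulVec_eq_three {ι : Type*} [Fintype ι] {N : Matrix ι ι ℂ} {u a b c : ι}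
    (hab : a ≠ b) (hac : a ≠ c) (hbc : b ≠ c) (hN : ∀ v, v ≠ a → v ≠ b → v ≠ c → N u v = 0)
    (ψ : ι → ℂ) : (N *ᵥ ψ) u = N u a * ψ a + N u b * ψ b + N u c * ψ c := by
  classical
  have h : ∑ v ∈ {a, b, c}, N u v * ψ v = ∑ v, N u v * ψ v := by
    refine Finset.sum_subset (Finset.subset_univ _) fun v _ hv => ?_
    simp only [Finset.mem_insert, Finset.mem_singleton, not_or] at hv
    simp [hN v hv.1 hv.2.1 hv.2.2]
  rw [Matrix.mulVec, dotProduct, ← h, Finset.sum_insert (by simp [hab, hac]),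
    Finset.sum_insert (by simp [hbc]), Finset.sum_singleton, add_assoc]

theorem east_injective {n : ℕ} : Function.Injective (east (n := n)) :=
  Function.LeftInverse.injective west_east

theorem north_injective {n : ℕ} : Function.Injective (north (n := n)) :=
  Function.LeftInverse.injective south_north

namespace IsKasteleynSign

variable {n : ℕ} {σ : Vertex n → Vertex n → ℂ}

section
variable [NeZero n] (hσ : IsKasteleynSign σ) (x : Bond n → ℝ) (ψ : Vertex n → ℂ) (p : Cell n)
include hσ

/-- The three neighbours are told apart by their sites, not their cells, so small tori, where `east
p = p` may occur, need no separate treatment. -/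
theorem mulVec_eq {u a b c : Vertex n} (hab : a.2 ≠ b.2) (hac : a.2 ≠ c.2) (hbc : b.2 ≠ c.2)
    (h : ∀ v, Link u v ∨ Link v u → v = a ∨ v = b ∨ v = c) :
    (signedMatrix σ x *ᵥ ψ) u = σ u a * edgeWeight x u a * ψ a +
      σ u b * edgeWeight x u b * ψ b + σ u c * edgeWeight x u c * ψ c := by
  refine mulVec_eq_three (ne_of_apply_ne _ hab) (ne_of_apply_ne _ hac) (ne_of_apply_ne _ hbc)
    (fun v ha hb hc => ?_) ψ
  have := mt (h v) (by simp [ha, hb, hc])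
  rw [not_or] at this
  simp [signedMatrix, hσ.eq_zero u v this.1 this.2]

theorem mulVec_hubNE : (signedMatrix σ x *ᵥ ψ) (p, .hubNE) =
    -σ (p, .right) (p, .hubNE) * ψ (p, .right) + σ (p, .hubNE) (p, .up) * ψ (p, .up) -
      σ (p, .hubSW) (p, .hubNE) * ψ (p, .hubSW) := by
  rw [hσ.mulVec_eq x ψ (a := (p, .right)) (b := (p, .up)) (c := (p, .hubSW)) (by simp) (by simp)
    (by simp), hσ.swap (p, .right), hσ.swap (p, .hubSW) (p, .hubNE)]
  · simp [edgeWeight, sub_eq_add_neg]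
  · rintro v (l | l) <;> generalize hu : ((p, Site.hubNE) : Vertex n) = u at l <;> cases l <;>
      simp_all

theorem mulVec_right : (signedMatrix σ x *ᵥ ψ) (p, .right) =
    σ (p, .right) (p, .hubNE) * ψ (p, .hubNE) - σ (p, .up) (p, .right) * ψ (p, .up) +
      σ (p, .right) (east p, .left) * x (.hor p) * ψ (east p, .left) := by
  rw [hσ.mulVec_eq x ψ (a := (p, .hubNE)) (b := (p, .up)) (c := (east p, .left)) (by simp)
    (by simp) (by simp), hσ.swap (p, .up)]
  · simp [edgeWeight, sub_eq_add_neg]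
  · rintro v (l | l) <;> generalize hu : ((p, Site.right) : Vertex n) = u at l <;> cases l <;>
      simp_all

theorem mulVec_up : (signedMatrix σ x *ᵥ ψ) (p, .up) =
    σ (p, .up) (p, .right) * ψ (p, .right) - σ (p, .hubNE) (p, .up) * ψ (p, .hubNE) +
      σ (p, .up) (north p, .down) * x (.ver p) * ψ (north p, .down) := by
  rw [hσ.mulVec_eq x ψ (a := (p, .right)) (b := (p, .hubNE)) (c := (north p, .down)) (by simp)
    (by simp) (by simp), hσ.swap (p, .hubNE)]
  · simp [edgeWeight, sub_eq_add_neg]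
  · rintro v (l | l) <;> generalize hu : ((p, Site.up) : Vertex n) = u at l <;> cases l <;>
      simp_all

theorem mulVec_hubSW : (signedMatrix σ x *ᵥ ψ) (p, .hubSW) =
    -σ (p, .left) (p, .hubSW) * ψ (p, .left) + σ (p, .hubSW) (p, .down) * ψ (p, .down) +
      σ (p, .hubSW) (p, .hubNE) * ψ (p, .hubNE) := by
  rw [hσ.mulVec_eq x ψ (a := (p, .left)) (b := (p, .down)) (c := (p, .hubNE)) (by simp) (by simp)
    (by simp), hσ.swap (p, .left)]
  · simp [edgeWeight]
  · rintro v (l | l) <;> generalize hu : ((p, Site.hubSW) : Vertex n) = u at l <;> cases l <;>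
      simp_all

theorem mulVec_left : (signedMatrix σ x *ᵥ ψ) (east p, .left) =
    σ (east p, .left) (east p, .hubSW) * ψ (east p, .hubSW) -
      σ (east p, .down) (east p, .left) * ψ (east p, .down) -
      σ (p, .right) (east p, .left) * x (.hor p) * ψ (p, .right) := by
  rw [hσ.mulVec_eq x ψ (a := (east p, .hubSW)) (b := (east p, .down)) (c := (p, .right)) (by simp)
    (by simp) (by simp), hσ.swap (east p, .down), hσ.swap (p, .right)]
  · simp [edgeWeight, sub_eq_add_neg]
  · rintro v (l | l) <;> generalize hu : ((east p, Site.left) : Vertex n) = u at l <;> cases l <;>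
      simp_all [east_injective.eq_iff]

theorem mulVec_down : (signedMatrix σ x *ᵥ ψ) (north p, .down) =
    σ (north p, .down) (north p, .left) * ψ (north p, .left) -
      σ (north p, .hubSW) (north p, .down) * ψ (north p, .hubSW) -
      σ (p, .up) (north p, .down) * x (.ver p) * ψ (p, .up) := by
  rw [hσ.mulVec_eq x ψ (a := (north p, .left)) (b := (north p, .hubSW)) (c := (p, .up)) (by simp)
    (by simp) (by simp), hσ.swap (north p, .hubSW), hσ.swap (p, .up)]
  · simp [edgeWeight, sub_eq_add_neg]
  · rintro v (l | l) <;> generalize hu : ((north p, Site.down) : Vertex n) = u at l <;>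
      cases l <;> simp_all [north_injective.eq_iff]

end

/-! ### Change of gauge, bond signs and corner variables. -/

/-- Vertex signs that bring the signs inside each cell to a standard form. -/
def gauge (σ : Vertex n → Vertex n → ℂ) : Vertex n → ℂ
  | (_, .hubSW) => 1
  | (p, .hubNE) => σ (p, .hubSW) (p, .hubNE)
  | (p, .right) => -(σ (p, .hubSW) (p, .hubNE) * σ (p, .right) (p, .hubNE))
  | (p, .up) => σ (p, .hubSW) (p, .hubNE) * σ (p, .hubNE) (p, .up)
  | (p, .left) => -σ (p, .left) (p, .hubSW)
  | (p, .down) => σ (p, .hubSW) (p, .down)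

/-- The sign of a horizontal bond after the change of gauge. -/
def horSign (σ : Vertex n → Vertex n → ℂ) (p : Cell n) : ℂ :=
  gauge σ (p, .right) * σ (p, .right) (east p, .left) * gauge σ (east p, .left)

/-- The sign of a vertical bond after the change of gauge. -/
def verSign (σ : Vertex n → Vertex n → ℂ) (p : Cell n) : ℂ :=
  gauge σ (p, .up) * σ (p, .up) (north p, .down) * gauge σ (north p, .down)

/-- The vertex variables, after the change of gauge, determined by corner variables. -/
def ofCorner (φ : Fin 4 → Cell n → ℂ) : Vertex n → ℂ
  | (p, .hubNE) => φ 1 p - φ 3 p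
  | (p, .right) => φ 0 p + φ 3 p
  | (p, .up) => φ 1 p - φ 0 p
  | (p, .hubSW) => φ 1 p + φ 3 p
  | (p, .left) => φ 2 p - φ 1 p
  | (p, .down) => φ 3 p - φ 2 p

section
variable (hσ : IsKasteleynSign σ)
include hσ

theorem mul_self' {u v : Vertex n} (l : Link v u) : σ u v * σ u v = 1 := by
  rw [hσ.swap, neg_mul_neg, hσ.mul_self _ _ l]

theorem gauge_mul_self (u : Vertex n) : gauge σ u * gauge σ u = 1 := by
  obtain ⟨p, s⟩ := u
  have hc := hσ.mul_self _ _ (.hub p)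
  cases s
  · exact hc
  · have := hσ.mul_self' (.hubNE_right p)
    rw [gauge, neg_mul_neg, mul_mul_mul_comm, hc, this, one_mul]
  · have := hσ.mul_self' (.up_hubNE p)
    rw [gauge, mul_mul_mul_comm, hc, this, one_mul]
  · simp [gauge]
  · have := hσ.mul_self' (.hubSW_left p)
    rw [gauge, neg_mul_neg, this]
  · exact hσ.mul_self' (.down_hubSW p)

theorem gauge_ne_zero (u : Vertex n) : gauge σ u ≠ 0 := fun h => by
  simpa [h] using hσ.gauge_mul_self u

theorem horSign_mul_self (p : Cell n) : horSign σ p * horSign σ p = 1 := by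
  have ha := hσ.gauge_mul_self (p, .right)
  have hb := hσ.mul_self _ _ (.hor p)
  have hc := hσ.gauge_mul_self (east p, .left)
  rw [horSign]
  generalize gauge σ (p, .right) = a at *
  generalize gauge σ (east p, .left) = c at *
  linear_combination σ (p, .right) (east p, .left) ^ 2 * c ^ 2 * ha + c ^ 2 * hb + hc

theorem verSign_mul_self (p : Cell n) : verSign σ p * verSign σ p = 1 := by
  have ha := hσ.gauge_mul_self (p, .up)
  have hb := hσ.mul_self _ _ (.ver p)
  have hc := hσ.gauge_mul_self (north p, .down)
  rw [verSign]
  generalize gauge σ (p, .up) = a at *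
  generalize gauge σ (north p, .down) = c at *
  linear_combination σ (p, .up) (north p, .down) ^ 2 * c ^ 2 * ha + c ^ 2 * hb + hc

/-- The change of gauge at the edge between `right` and `up`. -/
theorem gauge_right_mul_up (p : Cell n) :
    gauge σ (p, .right) * gauge σ (p, .up) = -σ (p, .up) (p, .right) := by
  have hc := hσ.mul_self _ _ (.hub p)
  have h := hσ.faceNE p
  have hs := hσ.mul_self' (.right_up p)
  simp only [gauge]
  -- `gauge` is fixed along the edges at the hubs, which form a spanning tree of the cell; the sign
  -- of the third edge of the triangle is then forced by the face condition.
  linear_combination (-σ (p, .up) (p, .right)) * h -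
    σ (p, .right) (p, .hubNE) * σ (p, .hubNE) (p, .up) * hc +
    σ (p, .right) (p, .hubNE) * σ (p, .hubNE) (p, .up) * hs

/-- The change of gauge at the edge between `left` and `down`. -/
theorem gauge_left_mul_down (p : Cell n) :
    gauge σ (p, .left) * gauge σ (p, .down) = -σ (p, .down) (p, .left) := by
  have h := hσ.faceSW p
  have hs := hσ.mul_self' (.left_down p)
  simp only [gauge]
  linear_combination (-σ (p, .down) (p, .left)) * h +
    σ (p, .left) (p, .hubSW) * σ (p, .hubSW) (p, .down) * hs

/-- This is the dodecagon condition in the new gauge: the gauge factors group by the four cells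
around the face, and each pair reproduces the product of signs along the part of the boundary inside
its cell, up to sign. -/
theorem horSign_mul_verSign (p : Cell n) :
    horSign σ p * verSign σ (east p) * horSign σ (north p) * verSign σ p = 1 := by
  have h := hσ.faceBig p
  have h1 := hσ.gauge_right_mul_up p
  have h2 := hσ.gauge_left_mul_down (north (east p))
  have h3 : gauge σ (east p, .left) * gauge σ (east p, .up) =
    -(σ (east p, .left) (east p, .hubSW) * σ (east p, .hubSW) (east p, .hubNE) *
      σ (east p, .hubNE) (east p, .up)) := by simp only [gauge]; ring
  have h4 : gauge σ (north p, .right) * gauge σ (north p, .down) =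
    -(σ (north p, .hubSW) (north p, .hubNE) * σ (north p, .right) (north p, .hubNE) *
      σ (north p, .hubSW) (north p, .down)) := by simp only [gauge]; ring
  have e : horSign σ p * verSign σ (east p) * horSign σ (north p) * verSign σ p =
      (gauge σ (p, .right) * gauge σ (p, .up)) *
      (gauge σ (north (east p), .left) * gauge σ (north (east p), .down)) *
      (gauge σ (east p, .left) * gauge σ (east p, .up)) *
      (gauge σ (north p, .right) * gauge σ (north p, .down)) *
      (σ (p, .right) (east p, .left) * σ (east p, .up) (north (east p), .down) *
        σ (north p, .right) (north (east p), .left) * σ (p, .up) (north p, .down)) := by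
    simp only [horSign, verSign, show east (north p) = north (east p) from rfl]
    ring
  rw [e, h1, h2, h3, h4]
  rw [hσ.swap (p, .up) (p, .right), hσ.swap (north p, .hubSW) (north p, .down),
    hσ.swap (north p, .right) (north p, .hubNE),
    hσ.swap (north (east p), .down) (north (east p), .left),
    hσ.swap (east p, .up) (north (east p), .down), hσ.swap (east p, .hubNE) (east p, .up),
    hσ.swap (east p, .hubSW) (east p, .hubNE), hσ.swap (east p, .left) (east p, .hubSW),
    hσ.swap (p, .right) (east p, .left)] at h
  linear_combination -h

end

/-! ### Kernel vectors as corner solutions. -/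

section
variable [NeZero n] (hσ : IsKasteleynSign σ) (x : Bond n → ℝ)
include hσ

/-- The rows are rescaled by `gauge`, which makes every edge inside a cell have a fixed sign. They
are grouped as the hub equations of a cell, then the two ends of its horizontal bond, then those of
its vertical bond. -/
theorem mulVec_gauge_eq_zero_iff (χ : Vertex n → ℂ) :
    signedMatrix σ x *ᵥ (fun u => gauge σ u * χ u) = 0 ↔ ∀ p,
      (χ (p, .hubSW) = χ (p, .right) + χ (p, .up) ∧
        χ (p, .hubNE) = -(χ (p, .left) + χ (p, .down))) ∧
      (-χ (p, .hubNE) + χ (p, .up) + horSign σ p * x (.hor p) * χ (east p, .left) = 0 ∧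
        -χ (east p, .hubSW) + χ (east p, .down) - horSign σ p * x (.hor p) * χ (p, .right) = 0) ∧
      (-χ (p, .right) - χ (p, .hubNE) + verSign σ p * x (.ver p) * χ (north p, .down) = 0 ∧
        -χ (north p, .left) - χ (north p, .hubSW) -
          verSign σ p * x (.ver p) * χ (p, .up) = 0) := by
  have hg := hσ.gauge_mul_self
  have hscale : ∀ {u : Vertex n} {a : ℂ},
      gauge σ u * (signedMatrix σ x *ᵥ fun u => gauge σ u * χ u) u = a →
      ((signedMatrix σ x *ᵥ fun u => gauge σ u * χ u) u = 0 ↔ a = 0) := by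
    rintro u a rfl
    simp [hσ.gauge_ne_zero u]
  have hNE : ∀ p, gauge σ (p, .hubNE) * (signedMatrix σ x *ᵥ fun u => gauge σ u * χ u) (p, .hubNE) =
      χ (p, .right) + χ (p, .up) - χ (p, .hubSW) := fun p => by
    have hc := hσ.mul_self _ _ (.hub p)
    have h1 := hσ.mul_self' (.hubNE_right p)
    have h2 := hσ.mul_self' (.up_hubNE p)
    rw [hσ.mulVec_hubNE]
    simp only [gauge]
    linear_combination (σ (p, .right) (p, .hubNE) ^ 2 * χ (p, .right) +
      σ (p, .hubNE) (p, .up) ^ 2 * χ (p, .up) - χ (p, .hubSW)) * hc +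
      χ (p, .right) * h1 + χ (p, .up) * h2
  have hSW : ∀ p, gauge σ (p, .hubSW) * (signedMatrix σ x *ᵥ fun u => gauge σ u * χ u) (p, .hubSW) =
      χ (p, .left) + χ (p, .down) + χ (p, .hubNE) := fun p => by
    have hc := hσ.mul_self _ _ (.hub p)
    have h1 := hσ.mul_self' (.hubSW_left p)
    have h2 := hσ.mul_self' (.down_hubSW p)
    rw [hσ.mulVec_hubSW]
    simp only [gauge]
    linear_combination χ (p, .left) * h1 + χ (p, .down) * h2 + χ (p, .hubNE) * hc
  have hR : ∀ p, gauge σ (p, .right) * (signedMatrix σ x *ᵥ fun u => gauge σ u * χ u) (p, .right) =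
      -χ (p, .hubNE) + χ (p, .up) + horSign σ p * x (.hor p) * χ (east p, .left) := fun p => by
    have h1 : gauge σ (p, .right) * σ (p, .right) (p, .hubNE) * gauge σ (p, .hubNE) = -1 := by
      simp only [gauge]
      linear_combination (-σ (p, .right) (p, .hubNE) ^ 2) * hσ.mul_self _ _ (.hub p) -
        hσ.mul_self' (.hubNE_right p)
    have h2 := hσ.gauge_right_mul_up p
    have h3 := hσ.mul_self' (.right_up p)
    rw [hσ.mulVec_right, horSign]
    linear_combination χ (p, .hubNE) * h1 - σ (p, .up) (p, .right) * χ (p, .up) * h2 +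
      χ (p, .up) * h3
  have hU : ∀ p, gauge σ (p, .up) * (signedMatrix σ x *ᵥ fun u => gauge σ u * χ u) (p, .up) =
      -χ (p, .right) - χ (p, .hubNE) + verSign σ p * x (.ver p) * χ (north p, .down) :=
    fun p => by
    have h1 : gauge σ (p, .up) * σ (p, .hubNE) (p, .up) * gauge σ (p, .hubNE) = 1 := by
      simp only [gauge]
      linear_combination (σ (p, .hubNE) (p, .up) ^ 2) * hσ.mul_self _ _ (.hub p) +
        hσ.mul_self' (.up_hubNE p)
    have h2 := hσ.gauge_right_mul_up p
    have h3 := hσ.mul_self' (.right_up p)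
    rw [hσ.mulVec_up, verSign]
    linear_combination (-χ (p, .hubNE)) * h1 + σ (p, .up) (p, .right) * χ (p, .right) * h2 -
      χ (p, .right) * h3
  have hL : ∀ p, gauge σ (east p, .left) *
      (signedMatrix σ x *ᵥ fun u => gauge σ u * χ u) (east p, .left) =
      -χ (east p, .hubSW) + χ (east p, .down) - horSign σ p * x (.hor p) * χ (p, .right) :=
    fun p => by
    have h1 := hσ.mul_self' (.hubSW_left (east p))
    have h2 := hσ.gauge_left_mul_down (east p)
    have h3 := hσ.mul_self' (.left_down (east p))
    have h4 : gauge σ (east p, .left) * σ (east p, .left) (east p, .hubSW) *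
        gauge σ (east p, .hubSW) = -1 := by
      simp only [gauge]
      linear_combination -h1
    rw [hσ.mulVec_left, horSign]
    linear_combination χ (east p, .hubSW) * h4 -
      σ (east p, .down) (east p, .left) * χ (east p, .down) * h2 + χ (east p, .down) * h3
  have hD : ∀ p, gauge σ (north p, .down) *
      (signedMatrix σ x *ᵥ fun u => gauge σ u * χ u) (north p, .down) =
      -χ (north p, .left) - χ (north p, .hubSW) - verSign σ p * x (.ver p) * χ (p, .up) :=
    fun p => by
    have h1 := hσ.mul_self' (.down_hubSW (north p))
    have h2 := hσ.gauge_left_mul_down (north p)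
    have h3 := hσ.mul_self' (.left_down (north p))
    have h4 : gauge σ (north p, .down) * σ (north p, .hubSW) (north p, .down) *
        gauge σ (north p, .hubSW) = 1 := by
      simp only [gauge]
      linear_combination h1
    rw [hσ.mulVec_down, verSign]
    linear_combination (-χ (north p, .hubSW)) * h4 +
      σ (north p, .down) (north p, .left) * χ (north p, .left) * h2 - χ (north p, .left) * h3
  constructor
  · intro h p
    have h' := congrFun h
    refine ⟨⟨?_, ?_⟩, ⟨(hscale (hR p)).1 (h' _), (hscale (hL p)).1 (h' _)⟩,
      ⟨(hscale (hU p)).1 (h' _), (hscale (hD p)).1 (h' _)⟩⟩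
    · linear_combination -(hscale (hNE p)).1 (h' _)
    · linear_combination (hscale (hSW p)).1 (h' _)
  · intro h
    funext ⟨p, s⟩
    cases s
    · exact (hscale (hNE p)).2 (by linear_combination -(h p).1.1)
    · exact (hscale (hR p)).2 (h p).2.1.1
    · exact (hscale (hU p)).2 (h p).2.2.1
    · exact (hscale (hSW p)).2 (by linear_combination (h p).1.2)
    -- The rows at `left` and `down` are indexed by the bond that ends there, hence by the cell to
    -- the left or below.
    · have := (hscale (hL (west p))).2 (h (west p)).2.1.2
      rwa [east_west] at this
    · have := (hscale (hD (south p))).2 (h (south p)).2.2.2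
      rwa [north_south] at this

theorem det_signedMatrix_eq_zero_iff :
    (signedMatrix σ x).det = 0 ↔
      ∃ φ, φ ≠ 0 ∧ IsCornerSolution (horSign σ) (verSign σ) (fun b => (x b : ℂ)) φ := by
  rw [← Matrix.exists_mulVec_eq_zero_iff]
  constructor
  · rintro ⟨ψ, hψ, h⟩
    obtain ⟨χ, rfl⟩ : ∃ χ : Vertex n → ℂ, (fun u => gauge σ u * χ u) = ψ :=
      ⟨fun u => gauge σ u * ψ u, by
        funext u
        rw [← mul_assoc, hσ.gauge_mul_self, one_mul]⟩
    rw [hσ.mulVec_gauge_eq_zero_iff] at h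
    obtain ⟨φ, rfl⟩ : ∃ φ : Fin 4 → Cell n → ℂ, ofCorner φ = χ := by
      -- In `ofCorner` the variables at `up`, `left`, `down` are differences of consecutive corners,
      -- while `right` is a sum. The four therefore add up to `2 * φ 3`, and the other corners
      -- follow by successive subtraction.
      refine ⟨![fun p => (χ (p, .right) - χ (p, .up) - χ (p, .left) - χ (p, .down)) / 2,
        fun p => (χ (p, .right) + χ (p, .up) - χ (p, .left) - χ (p, .down)) / 2,
        fun p => (χ (p, .right) + χ (p, .up) + χ (p, .left) - χ (p, .down)) / 2,
        fun p => (χ (p, .right) + χ (p, .up) + χ (p, .left) + χ (p, .down)) / 2], ?_⟩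
      funext ⟨p, s⟩
      have h1 := (h p).1.1
      have h2 := (h p).1.2
      cases s <;> simp only [ofCorner] <;> simp
      · linear_combination -h2
      · ring
      · ring
      · linear_combination -h1
      · ring
      · ring
    refine ⟨φ, ?_, fun p => ?_⟩
    · rintro rfl
      refine hψ (funext fun ⟨p, s⟩ => ?_)
      cases s <;> simp [ofCorner]
    · obtain ⟨-, ⟨h1, h2⟩, h3, h4⟩ := h p
      simp only [ofCorner] at h1 h2 h3 h4
      refine ⟨⟨?_, ?_⟩, ?_, ?_⟩
      · linear_combination h1
      · linear_combination -h2
      · linear_combination h3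
      · linear_combination -h4
  · rintro ⟨φ, hφ, h⟩
    refine ⟨fun u => gauge σ u * ofCorner φ u, fun h0 => hφ ?_, ?_⟩
    · have h1 : ∀ u, ofCorner φ u = 0 := fun u => by
        simpa [hσ.gauge_ne_zero u] using congrFun h0 u
      funext i p
      have hNE := h1 (p, .hubNE)
      have hSW := h1 (p, .hubSW)
      have hR := h1 (p, .right)
      have hD := h1 (p, .down)
      simp only [ofCorner] at hNE hSW hR hD
      fin_cases i <;> simp
      · linear_combination hR - (1/2 : ℂ) * (hSW - hNE)
      · linear_combination (1/2 : ℂ) * (hSW + hNE)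
      · linear_combination (1/2 : ℂ) * (hSW - hNE) - hD
      · linear_combination (1/2 : ℂ) * (hSW - hNE)
    · rw [hσ.mulVec_gauge_eq_zero_iff]
      intro p
      obtain ⟨⟨h1, h2⟩, h3, h4⟩ := h p
      simp only [ofCorner]
      refine ⟨⟨by ring, by ring⟩, ⟨?_, ?_⟩, ?_, ?_⟩
      · linear_combination h1
      · linear_combination -h2
      · linear_combination h3
      · linear_combination -h4

end

end IsKasteleynSign

/-! ### The Ising weights and the conclusion. -/

theorem exp_neg_two_mul_mul_one_add_tanh (t : ℝ) :
    Real.exp (-2 * t) * (1 + Real.tanh t) = 1 - Real.tanh t := by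
  have h : Real.exp (-2 * t) = Real.exp (-t) * Real.exp (-t) := by rw [← Real.exp_add]; ring_nf
  have h1 : Real.exp t * Real.exp (-t) = 1 := by rw [← Real.exp_add]; simp
  have h2 : Real.exp t + Real.exp (-t) ≠ 0 := by positivity
  rw [h, Real.tanh_eq]
  field_simp
  linear_combination (2 * Real.exp (-t)) * h1

theorem charPoly_lowTempWeight_eq_zero_iff {n : ℕ} [NeZero n] (J : Bond n → ℝ)
    {o : Orientation n} (ho : o.ClockwiseOdd) {z w : ℂ} (hz : z * z = 1) (hw : w * w = 1) :
    charPoly o (lowTempWeight J) z w = 0 ↔ charPoly o (highTempWeight J) z w = 0 := by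
  have hσ := ho.isKasteleynSign hz hw
  have hK : ∀ x, charPoly o x z w = (signedMatrix (o.twistedSign z w) x).det := fun x => by
    rw [charPoly]
    congr 1
    ext u v
    exact kasteleynZW_apply o x hz hw u v
  rw [hK, hK, hσ.det_signedMatrix_eq_zero_iff, hσ.det_signedMatrix_eq_zero_iff]
  refine exists_isCornerSolution_dual hσ.horSign_mul_self hσ.verSign_mul_self
    hσ.horSign_mul_verSign (fun b => ?_) (fun b => ?_)
  -- The duality is applied with `x = tanh J`, for which `1 + x > 0`.
  · have := Real.neg_one_lt_tanh (J b)
    have h : 1 + highTempWeight J b ≠ 0 := by rw [highTempWeight]; linarith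
    exact_mod_cast h
  · simp only [lowTempWeight, highTempWeight, Equiv.symm_apply_apply]
    exact_mod_cast exp_neg_two_mul_mul_one_add_tanh (J b)

end FisherTorus

theorem proposition3p1 (n : ℕ) [NeZero n] (J : FisherTorus.Bond n → ℝ)
    (o : FisherTorus.Orientation n) (ho : o.ClockwiseOdd) (θ τ : Fin 2) :
    FisherTorus.charPoly o (FisherTorus.lowTempWeight J)
        ((-1) ^ (θ : ℕ)) ((-1) ^ (τ : ℕ)) = 0 ↔
      FisherTorus.charPoly o (FisherTorus.highTempWeight J)
        ((-1) ^ (θ : ℕ)) ((-1) ^ (τ : ℕ)) = 0 := by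
  have h : ∀ k : ℕ, (-1 : ℂ) ^ k * (-1) ^ k = 1 := fun k => by
    rw [← mul_pow]; simp
  exact FisherTorus.charPoly_lowTempWeight_eq_zero_iff J ho (h θ) (h τ)
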